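/- Let $G$ be a finite simple graph. In positive semidefinite (PSD) zero forcing, an initial set of vertices of $G$ is colored blue and the other vertices are white. In each round, let $S$ be the current set of blue vertices and let $W_1,\dots,W_r$ be the vertex sets of the connected components of $G-S$; a white vertex $w$ becomes blue in this round if and only if there are a blue vertex $v$ adjacent to $w$ and an index $i$ such that $w$ is the only white neighbor of $v$ in the subgraph of $G$ induced by $W_i\cup S$ (all such $w$ are colored simultaneously). Let $\operatorname{pt}_+(G,k)$ be the minimum, over all initial blue sets of size $k$, of the number of rounds until all of $G$ is blue ($\infty$ if no initial blue set of size $k$ ever colors all of $G$), and let the PSD throttling number be $\operatorname{th}_+(G)=\min_k\{k+\operatorname{pt}_+(G,k)\}$, the minimum being over nonnegative integers $k$. There is an absolute constant $C$ such that for every $n$ and every tree $T$ on $n$ vertices, $$\operatorname{th}_+(T)\le \frac{\sqrt{14}}{2}\sqrt{n}+C .$$ -/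

import Mathlib

namespace PSDForcing

variable {V : Type*}

/-- The set of vertices of a connected component `W` of `G - S`, as a set of vertices of `G`. -/
def componentVerts (G : SimpleGraph V) (S : Set V)
    (W : (G.induce Sᶜ).ConnectedComponent) : Set V :=
  Subtype.val '' W.supp

/-- With blue set `S`, the blue vertex `v` colors the white vertex `w` blue: for some component
`W` of `G - S`, `w` is the only white neighbor of `v` in the subgraph induced by `W ∪ S`
(the white vertices of that subgraph are exactly the vertices of `W`). -/
def Forces (G : SimpleGraph V) (S : Set V) (v w : V) : Prop :=
  v ∈ S ∧ ∃ W : (G.induce Sᶜ).ConnectedComponent,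
    w ∈ componentVerts G S W ∧ G.Adj v w ∧
      ∀ u ∈ componentVerts G S W, G.Adj v u → u = w

/-- The blue set after one round of PSD zero forcing: all possible forces are performed
simultaneously. -/
def step (G : SimpleGraph V) (S : Set V) : Set V :=
  S ∪ {w | ∃ v, Forces G S v w}

/-- The blue set after `t` rounds, when `S` is the initial blue set. -/
def blueAfter (G : SimpleGraph V) (S : Set V) (t : ℕ) : Set V :=
  (step G)^[t] S

/-- The number of rounds needed for the initial blue set `S` to color all of `G` blue
(`⊤` if this never happens). -/
noncomputable def propTime (G : SimpleGraph V) (S : Set V) : ℕ∞ :=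
  ⨅ (t : ℕ) (_ : blueAfter G S t = Set.univ), (t : ℕ∞)

/-- `pt₊(G, k)`: the minimum of the propagation times over all initial blue sets of size `k`
(`⊤` if no such set colors all of `G`). -/
noncomputable def ptPlus (G : SimpleGraph V) (k : ℕ) : ℕ∞ :=
  ⨅ (S : Finset V) (_ : S.card = k), propTime G (S : Set V)

/-- The PSD throttling number `th₊(G) = min_k (k + pt₊(G, k))`. -/
noncomputable def thPlus (G : SimpleGraph V) : ℕ∞ :=
  ⨅ k : ℕ, ((k : ℕ∞) + ptPlus G k)

end PSDForcing

namespace PSDForcing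

open SimpleGraph

variable {V : Type*}

/-! In a tree, distinct white neighbors of a blue vertex lie in different components of white
vertices, so blue spreads to all neighbors in every round. It remains to cover the tree by few balls
of small radius. For each `t > 0` there are covers of radii `3t` and `4t` with at most `n/(2t) + 2`
centers in total (`exists_two_covers`). If `n ≤ 14t²`, the two costs, size plus radius, sum to at
most `14t + 2`, so one is at most `7t + 1`. Taking `t = ⌈√(n/14)⌉` gives the constant `7/√14 =
√14/2`. -/

/-- Some walk of length at most `r` leads from `s` to `x`. -/
def Within (G : SimpleGraph V) (r : ℕ) (s x : V) : Prop :=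
  ∃ w : G.Walk s x, w.length ≤ r

/-- The balls of radius `r` around the vertices of `S` cover `A`. -/
def Covers (G : SimpleGraph V) (r : ℕ) (S A : Finset V) : Prop :=
  ∀ x ∈ A, ∃ s ∈ S, Within G r s x

theorem Within.mono {G : SimpleGraph V} {r r' : ℕ} {s x : V} (h : Within G r s x)
    (hr : r ≤ r') : Within G r' s x := by
  obtain ⟨w, hw⟩ := h
  exact ⟨w, hw.trans hr⟩

/-! ### Rooted spanning trees and their subtrees -/

/-- `p` is the parent function, and `d` the depth function, of a spanning tree of `A` with root
`u` whose edges are edges of `G`. -/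
structure IsParentMap (G : SimpleGraph V) (A : Finset V) (u : V) (p : V → V) (d : V → ℕ) :
    Prop where
  root_mem : u ∈ A
  depth_root : d u = 0
  parent : ∀ x ∈ A, x ≠ u → p x ∈ A ∧ G.Adj (p x) x ∧ d x = d (p x) + 1

theorem exists_isParentMap {G : SimpleGraph V} {A : Finset V} {u : V} (hu : u ∈ A)
    (hA : (G.induce (A : Set V)).Connected) : ∃ p d, IsParentMap G A u p d := by
  classical
  obtain ⟨u', rfl⟩ : ∃ u' : (A : Set V), (u' : V) = u := ⟨⟨u, hu⟩, rfl⟩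
  let d : V → ℕ := fun x => if h : x ∈ A then (G.induce (A : Set V)).dist ⟨x, h⟩ u' else 0
  have key : ∀ x : V, x ∈ A → x ≠ u' → ∃ y, y ∈ A ∧ G.Adj y x ∧ d x = d y + 1 := by
    intro x hx hxu
    obtain ⟨w, hw⟩ := hA.exists_walk_length_eq_dist ⟨x, hx⟩ u'
    cases w with
    | nil => exact absurd rfl hxu
    | @cons _ y _ h q =>
      refine ⟨y, y.2, (SimpleGraph.comap_adj.1 h).symm, ?_⟩
      have h1 := dist_le q
      have h2 := hA.dist_triangle (u := ⟨x, hx⟩) (v := y) (w := u')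
      have h3 := dist_le h.toWalk
      have hy : (y : V) ∈ A := y.2
      simp only [d, hx, hy, dif_pos]
      simp only [Walk.length_cons, Walk.length_nil, Adj.toWalk] at hw h3
      have : (⟨(y : V), hy⟩ : (A : Set V)) = y := rfl
      rw [this]
      omega
  have : Nonempty V := ⟨u'⟩
  choose! p hp using key
  exact ⟨p, d, hu, by simp [d], hp⟩

namespace IsParentMap

variable {G : SimpleGraph V} {A : Finset V} {u : V} {p : V → V} {d : V → ℕ}

theorem ne_root (h : IsParentMap G A u p d) {x : V} (hx : 0 < d x) : x ≠ u := by
  rintro rfl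
  rw [h.depth_root] at hx
  exact lt_irrefl _ hx

theorem iterate (h : IsParentMap G A u p d) {x : V} (hx : x ∈ A) {i : ℕ} (hi : i ≤ d x) :
    p^[i] x ∈ A ∧ d (p^[i] x) + i = d x ∧ Within G i (p^[i] x) x := by
  induction i with
  | zero => exact ⟨hx, rfl, Walk.nil, le_rfl⟩
  | succ i ih =>
    obtain ⟨h1, h2, w, hw⟩ := ih (by omega)
    obtain ⟨h3, h4, h5⟩ := h.parent _ h1 (h.ne_root (by omega))
    rw [Function.iterate_succ_apply']
    exact ⟨h3, by omega, Walk.cons h4 w, by simpa using hw⟩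

theorem iterate_depth (h : IsParentMap G A u p d) {x : V} (hx : x ∈ A) : p^[d x] x = u := by
  by_contra hne
  obtain ⟨h1, h2, -⟩ := h.iterate hx le_rfl
  have := (h.parent _ h1 hne).2.2
  omega

theorem within_root (h : IsParentMap G A u p d) {x : V} (hx : x ∈ A) : Within G (d x) u x := by
  have := (h.iterate hx le_rfl).2.2
  rwa [h.iterate_depth hx] at this

end IsParentMap

open Classical in
/-- The vertices of `A` that lie in the subtree below `v`. -/
noncomputable def subtree (A : Finset V) (p : V → V) (d : V → ℕ) (v : V) : Finset V :=
  -- The bound `i ≤ d y` stops the climb at the root, where `p` is arbitrary.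
  A.filter fun y => ∃ i ≤ d y, p^[i] y = v

theorem mem_subtree {A : Finset V} {p : V → V} {d : V → ℕ} {v y : V} :
    y ∈ subtree A p d v ↔ y ∈ A ∧ ∃ i ≤ d y, p^[i] y = v := by
  simp [subtree]

theorem subtree_subset (A : Finset V) (p : V → V) (d : V → ℕ) (v : V) : subtree A p d v ⊆ A :=
  fun _ hy => (mem_subtree.1 hy).1

namespace IsParentMap

variable {G : SimpleGraph V} {A : Finset V} {u : V} {p : V → V} {d : V → ℕ}

theorem depth_le_of_mem_subtree (h : IsParentMap G A u p d) {v y : V}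
    (hy : y ∈ subtree A p d v) : d v ≤ d y ∧ Within G (d y - d v) v y := by
  obtain ⟨hyA, i, hi, rfl⟩ := mem_subtree.1 hy
  obtain ⟨-, h2, h3⟩ := h.iterate hyA hi
  exact ⟨by omega, h3.mono (by omega)⟩

theorem parent_mem_subtree (h : IsParentMap G A u p d) {v y : V}
    (hy : y ∈ subtree A p d v) (hne : y ≠ v) : y ≠ u ∧ p y ∈ subtree A p d v := by
  obtain ⟨hyA, i, hi, hiv⟩ := mem_subtree.1 hy
  cases i with
  | zero => exact absurd hiv hne
  | succ i =>
    have hyu : y ≠ u := h.ne_root (by omega)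
    obtain ⟨h1, -, h3⟩ := h.parent y hyA hyu
    exact ⟨hyu, mem_subtree.2 ⟨h1, i, by omega, hiv⟩⟩

theorem mem_subtree_of_parent (h : IsParentMap G A u p d) {v y : V} (hyA : y ∈ A) (hyu : y ≠ u)
    (hy : p y ∈ subtree A p d v) : y ∈ subtree A p d v := by
  obtain ⟨-, i, hi, hiv⟩ := mem_subtree.1 hy
  have := (h.parent y hyA hyu).2.2
  exact mem_subtree.2 ⟨hyA, i + 1, by omega, hiv⟩

theorem sdiff_subtree [DecidableEq V] (h : IsParentMap G A u p d) {v : V} (hv : 0 < d v) :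
    IsParentMap G (A \ subtree A p d v) u p d where
  root_mem := by
    refine Finset.mem_sdiff.2 ⟨h.root_mem, fun hu => ?_⟩
    have := (h.depth_le_of_mem_subtree hu).1
    rw [h.depth_root] at this
    omega
  depth_root := h.depth_root
  parent x hx hxu := by
    obtain ⟨hxA, hxv⟩ := Finset.mem_sdiff.1 hx
    obtain ⟨h1, h2⟩ := h.parent x hxA hxu
    exact ⟨Finset.mem_sdiff.2 ⟨h1, fun hp => hxv (h.mem_subtree_of_parent hxA hxu hp)⟩, h2⟩

theorem lt_card_subtree (h : IsParentMap G A u p d) {x : V} (hx : x ∈ A) {i : ℕ}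
    (hi : i ≤ d x) : i < (subtree A p d (p^[i] x)).card := by
  classical
  have hcard : ((Finset.range (i + 1)).image fun j => p^[j] x).card = i + 1 := by
    rw [Finset.card_image_of_injOn, Finset.card_range]
    intro a ha b hb hab
    simp only [Finset.coe_range, Set.mem_Iio] at ha hb
    have h1 := (h.iterate hx (i := a) (by omega)).2.1
    have h2 := (h.iterate hx (i := b) (by omega)).2.1
    simp only at hab
    rw [hab] at h1
    omega
  rw [← Nat.succ_le_iff, Nat.succ_eq_add_one, ← hcard]
  refine Finset.card_le_card fun y hy => ?_
  obtain ⟨j, hj, rfl⟩ := Finset.mem_image.1 hy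
  have hj : j ≤ i := by simpa [Nat.lt_succ_iff] using hj
  obtain ⟨h1, h2, -⟩ := h.iterate hx (i := j) (by omega)
  refine mem_subtree.2 ⟨h1, i - j, by omega, ?_⟩
  rw [← Function.iterate_add_apply, Nat.sub_add_cancel hj]

theorem connected (h : IsParentMap G A u p d) : (G.induce (A : Set V)).Connected := by
  rw [connected_iff_exists_forall_reachable]
  refine ⟨⟨u, h.root_mem⟩, ?_⟩
  have key : ∀ n, ∀ x (hx : x ∈ A), d x = n →
      (G.induce (A : Set V)).Reachable ⟨u, h.root_mem⟩ ⟨x, hx⟩ := by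
    intro n
    induction n with
    | zero =>
      intro x hx hn
      have : x = u := by
        by_contra hne
        have := (h.parent x hx hne).2.2
        omega
      subst this
      exact Reachable.refl _
    | succ n ih =>
      intro x hx hn
      obtain ⟨h1, h2, h3⟩ := h.parent x hx (h.ne_root (by omega))
      refine (ih (p x) h1 (by omega)).trans (Adj.reachable ?_)
      exact SimpleGraph.comap_adj.2 h2
  exact fun x => key _ x.1 x.2 rfl

/-! ### Covers by balls -/

/-- A graph can be covered by balls of radius `r`, one of them around a given vertex, each of the
others using up `r + 1` vertices. -/
theorem exists_covers [DecidableEq V] (h : IsParentMap G A u p d) (r : ℕ) :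
    ∃ S : Finset V, S.Nonempty ∧ u ∈ S ∧ (r + 1) * S.card ≤ A.card + r ∧ Covers G r S A := by
  induction hn : A.card using Nat.strong_induction_on generalizing A with
  | _ n ih =>
  by_cases hd : ∀ x ∈ A, d x ≤ r
  · refine ⟨{u}, Finset.singleton_nonempty u, Finset.mem_singleton_self u, ?_, fun x hx =>
      ⟨u, Finset.mem_singleton_self u, (h.within_root hx).mono (hd x hx)⟩⟩
    have := Finset.card_pos.2 ⟨u, h.root_mem⟩
    simp only [Finset.card_singleton]
    omega
  · push Not at hd
    obtain ⟨x₀, hx₀, hx₀r⟩ := hd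
    obtain ⟨x, hx, hmax⟩ := A.exists_max_image d ⟨u, h.root_mem⟩
    have hxr : r < d x := hx₀r.trans_le (hmax x₀ hx₀)
    have hv := (h.iterate hx hxr.le).2.1
    have hcard := h.lt_card_subtree hx hxr.le
    -- As `x` is deepest, the ball around `v` covers the whole subtree below `v`, which is then cut
    -- off.
    set v := p^[r] x with hvdef
    have hsub := Finset.card_sdiff_add_card_eq_card (subtree_subset A p d v)
    obtain ⟨S, -, huS, hS, hcov⟩ := ih _ (by omega) (h.sdiff_subtree (v := v) (by omega)) rfl
    refine ⟨insert v S, ⟨v, Finset.mem_insert_self v S⟩, Finset.mem_insert_of_mem huS, ?_,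
      fun y hy => ?_⟩
    · have h1 := Finset.card_insert_le v S
      have h2 := Nat.mul_le_mul_left (r + 1) h1
      rw [Nat.mul_add, Nat.mul_one] at h2
      omega
    · by_cases hyv : y ∈ subtree A p d v
      · have hyd := h.depth_le_of_mem_subtree hyv
        have := hmax y hy
        exact ⟨v, Finset.mem_insert_self v S, hyd.2.mono (by omega)⟩
      · obtain ⟨s, hs, hsy⟩ := hcov y (Finset.mem_sdiff.2 ⟨hy, hyv⟩)
        exact ⟨s, Finset.mem_insert_of_mem hs, hsy⟩

theorem subtree_sdiff_subtree [DecidableEq V] (h : IsParentMap G A u p d) {v w : V}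
    (hv : v ∈ A) (hvw : d v < d w) :
    IsParentMap G (subtree A p d v \ subtree A p d w) v p (fun x => d x - d v) where
  root_mem := by
    refine Finset.mem_sdiff.2 ⟨mem_subtree.2 ⟨hv, 0, Nat.zero_le _, rfl⟩, fun hm => ?_⟩
    have := (h.depth_le_of_mem_subtree hm).1
    omega
  depth_root := Nat.sub_self _
  parent x hx hxv := by
    obtain ⟨h1, h2⟩ := Finset.mem_sdiff.1 hx
    obtain ⟨hxu, hpx⟩ := h.parent_mem_subtree h1 hxv
    obtain ⟨-, h3, h4⟩ := h.parent x (subtree_subset _ _ _ _ h1) hxu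
    refine ⟨Finset.mem_sdiff.2 ⟨hpx, fun hw =>
      h2 (h.mem_subtree_of_parent (subtree_subset _ _ _ _ h1) hxu hw)⟩, h3, ?_⟩
    have := (h.depth_le_of_mem_subtree hpx).1
    omega

/-- The subtree below the ancestor `v` of `x` at distance `b` is covered by balls of radius `a`,
each of which uses up `a + 1` vertices. -/
theorem exists_covers_subtree [DecidableEq V] (h : IsParentMap G A u p d) {x : V} (hx : x ∈ A)
    (hmax : ∀ y ∈ A, d y ≤ d x) {a b : ℕ} (hab : a < b) (hb : b ≤ d x) :
    ∃ S : Finset V, S.Nonempty ∧ (a + 1) * S.card ≤ (subtree A p d (p^[b] x)).card ∧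
      Covers G a S (subtree A p d (p^[b] x)) := by
  obtain ⟨hvA, hvd, -⟩ := h.iterate hx hb
  obtain ⟨hwA, hwd, -⟩ := h.iterate hx (hab.le.trans hb)
  have hDcard := h.lt_card_subtree hx (hab.le.trans hb)
  have hwC : p^[a] x ∈ subtree A p d (p^[b] x) := by
    refine mem_subtree.2 ⟨hwA, b - a, by omega, ?_⟩
    rw [← Function.iterate_add_apply, Nat.sub_add_cancel hab.le]
  set v := p^[b] x
  set w := p^[a] x
  have hvw : d v < d w := by omega
  have hE := h.subtree_sdiff_subtree hvA hvw
  have hDC : subtree A p d w ⊆ subtree A p d v := by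
    intro y hy
    obtain ⟨hyA, i, hi, hiw⟩ := mem_subtree.1 hy
    have hyd := (h.iterate hyA hi).2.1
    obtain ⟨-, j, hj, hjv⟩ := mem_subtree.1 hwC
    rw [hiw] at hyd
    refine mem_subtree.2 ⟨hyA, j + i, by omega, ?_⟩
    rw [Function.iterate_add_apply, hiw, hjv]
  have hsub := Finset.card_sdiff_add_card_eq_card hDC
  obtain ⟨hwu, hpw⟩ := h.parent_mem_subtree hwC (by rintro heq; rw [heq] at hvw; omega)
  obtain ⟨-, hadj, hdw⟩ := h.parent w hwA hwu
  have hpE : p w ∈ subtree A p d v \ subtree A p d w := by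
    refine Finset.mem_sdiff.2 ⟨hpw, fun hm => ?_⟩
    have := (h.depth_le_of_mem_subtree hm).1
    omega
  set E := subtree A p d v \ subtree A p d w
  -- Rerooting `E` at `w` makes `w` a center, whose ball also covers the subtree below `w`. The at
  -- least `a + 1` vertices of that subtree pay for the slack `a` and for counting `w` with `E`.
  have hconn : (G.induce ((insert w E : Finset V) : Set V)).Connected := by
    have := connected_induce_union (v := p w) (w := w) hE.connected.preconnected
      (t := {w}) (by exact Preconnected.of_subsingleton) hpE rfl hadj
    rwa [Set.union_comm, ← Set.insert_eq, ← Finset.coe_insert] at this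
  obtain ⟨p', d', h'⟩ := exists_isParentMap (Finset.mem_insert_self w E) hconn
  obtain ⟨S, hSne, hwS, hS, hcov⟩ := h'.exists_covers a
  refine ⟨S, hSne, ?_, fun y hy => ?_⟩
  · have := Finset.card_insert_le w E
    omega
  · by_cases hyw : y ∈ subtree A p d w
    · have h1 := h.depth_le_of_mem_subtree hyw
      have h2 := hmax y (subtree_subset _ _ _ _ hyw)
      exact ⟨w, hwS, h1.2.mono (by omega)⟩
    · exact hcov y (Finset.mem_insert_of_mem (Finset.mem_sdiff.2 ⟨hy, hyw⟩))

/-- Cut off the subtree `C` below the ancestor at distance `4t` from a deepest vertex. One ball of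
radius `4t` covers `C`, and `s` balls of radius `3t` do, with `(3t + 1)s ≤ |C|`. -/
theorem exists_two_covers [DecidableEq V] (h : IsParentMap G A u p d) {t : ℕ} (ht : 0 < t) :
    ∃ S₁ S₂ : Finset V, 2 * t * (S₁.card + S₂.card) ≤ A.card + 4 * t ∧
      Covers G (3 * t) S₁ A ∧ Covers G (4 * t) S₂ A := by
  induction hn : A.card using Nat.strong_induction_on generalizing A with
  | _ n ih =>
  by_cases hd : ∀ x ∈ A, d x ≤ 4 * t
  · obtain ⟨S, -, -, hS, hcov⟩ := h.exists_covers (3 * t)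
    refine ⟨S, {u}, ?_, hcov, fun x hx =>
      ⟨u, Finset.mem_singleton_self u, (h.within_root hx).mono (hd x hx)⟩⟩
    simp only [Finset.card_singleton]
    nlinarith
  · push Not at hd
    obtain ⟨x₀, hx₀, hx₀r⟩ := hd
    obtain ⟨x, hx, hmax⟩ := A.exists_max_image d ⟨u, h.root_mem⟩
    have hxt : 4 * t < d x := hx₀r.trans_le (hmax x₀ hx₀)
    have hv := (h.iterate hx hxt.le).2.1
    have hcard := h.lt_card_subtree hx hxt.le
    obtain ⟨S, hSne, hS, hScov⟩ := h.exists_covers_subtree hx hmax (a := 3 * t) (b := 4 * t)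
      (by omega) hxt.le
    set v := p^[4 * t] x
    have hsub := Finset.card_sdiff_add_card_eq_card (subtree_subset A p d v)
    obtain ⟨S₁, S₂, hS₁₂, hcov₁, hcov₂⟩ :=
      ih _ (by omega) (h.sdiff_subtree (v := v) (by omega)) rfl
    refine ⟨S₁ ∪ S, insert v S₂, ?_, fun y hy => ?_, fun y hy => ?_⟩
    · have h1 := Finset.card_union_le S₁ S
      have h2 := Finset.card_insert_le v S₂
      -- One center: `|C| > 4t`. For `s ≥ 2` centers: `2(s + 1) ≤ 3s`.
      have h3 : 2 * t * (S.card + 1) ≤ (subtree A p d v).card := by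
        rcases (Nat.succ_le_iff.2 (Finset.card_pos.2 hSne)).eq_or_lt with h4 | h4
        · rw [← h4]
          omega
        · have h5 : 2 ≤ S.card := h4
          nlinarith
      have h4 : 2 * t * ((S₁ ∪ S).card + (insert v S₂).card) ≤
          2 * t * ((S₁.card + S₂.card) + (S.card + 1)) := Nat.mul_le_mul_left _ (by omega)
      rw [Nat.mul_add (2 * t) (S₁.card + S₂.card)] at h4
      omega
    · by_cases hyv : y ∈ subtree A p d v
      · obtain ⟨s, hs, hsy⟩ := hScov y hyv
        exact ⟨s, Finset.mem_union_right _ hs, hsy⟩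
      · obtain ⟨s, hs, hsy⟩ := hcov₁ y (Finset.mem_sdiff.2 ⟨hy, hyv⟩)
        exact ⟨s, Finset.mem_union_left _ hs, hsy⟩
    · by_cases hyv : y ∈ subtree A p d v
      · have hyd := h.depth_le_of_mem_subtree hyv
        have := hmax y hy
        exact ⟨v, Finset.mem_insert_self v S₂, hyd.2.mono (by omega)⟩
      · obtain ⟨s, hs, hsy⟩ := hcov₂ y (Finset.mem_sdiff.2 ⟨hy, hyv⟩)
        exact ⟨s, Finset.mem_insert_of_mem hs, hsy⟩

end IsParentMap

/-! ### Forcing in forests and the final bound -/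

theorem mem_step_of_adj {G : SimpleGraph V} (hG : G.IsAcyclic) {S : Set V} {v w : V}
    (hv : v ∈ S) (hvw : G.Adj v w) : w ∈ step G S := by
  by_cases hw : w ∈ S
  · exact Or.inl hw
  let w' : (Sᶜ : Set V) := ⟨w, hw⟩
  refine Or.inr ⟨v, hv, (G.induce Sᶜ).connectedComponentMk w', ⟨w', rfl, rfl⟩, hvw, ?_⟩
  rintro _ ⟨u, hu, rfl⟩ hvu
  by_contra hne
  -- A second white neighbor `u` in the component would be joined to `w` by two paths, one avoiding
  -- `v` and one through `v`.
  obtain ⟨q, hq⟩ := (ConnectedComponent.exact hu).exists_isPath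
  let f : G.induce Sᶜ →g G := (Embedding.induce Sᶜ).toHom
  have hf : Function.Injective f := Subtype.val_injective
  have hq' : (q.map f).IsPath := hq.map hf
  have hvq : v ∉ (q.map f).support := by
    rw [Walk.support_map]
    intro hm
    obtain ⟨y, -, hy⟩ := List.mem_map.1 hm
    exact y.2 (by rw [show (y : V) = v from hy]; exact hv)
  have hr : (Walk.cons hvu.symm (Walk.cons hvw Walk.nil)).IsPath := by
    simp [Walk.cons_isPath_iff, hvw.ne, hvu.ne', hne]
  have := congrArg (fun P : G.Path (u : V) w => v ∈ (P : G.Walk (u : V) w).support)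
    ((hG.subsingleton_path _ _).elim ⟨_, hq'⟩ ⟨_, hr⟩)
  exact hvq (this.mpr (by simp))

theorem mem_blueAfter_of_walk {G : SimpleGraph V} (hG : G.IsAcyclic) {S : Set V} {s x : V}
    (w : G.Walk s x) (hs : s ∈ S) {r : ℕ} (hr : w.length ≤ r) : x ∈ blueAfter G S r := by
  induction r generalizing S s with
  | zero =>
    cases w with
    | nil => exact hs
    | cons h q => simp at hr
  | succ r ih =>
    change x ∈ (step G)^[r] (step G S)
    cases w with
    | nil => exact ih Walk.nil (Or.inl hs) (Nat.zero_le _)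
    | cons h q => exact ih q (mem_step_of_adj hG hs h) (by simpa using hr)

theorem thPlus_le_of_covers [Fintype V] {G : SimpleGraph V} (hG : G.IsAcyclic) {S : Finset V}
    {r : ℕ} (h : Covers G r S Finset.univ) : thPlus G ≤ ((S.card + r : ℕ) : ℕ∞) := by
  have hblue : blueAfter G (S : Set V) r = Set.univ := by
    refine Set.eq_univ_of_forall fun x => ?_
    obtain ⟨s, hs, w, hw⟩ := h x (Finset.mem_univ x)
    exact mem_blueAfter_of_walk hG w hs hw
  have h1 : propTime G (S : Set V) ≤ r := iInf₂_le r hblue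
  have h2 : ptPlus G S.card ≤ r := (iInf₂_le (f := fun (S' : Finset V)
    (_ : S'.card = S.card) => propTime G (S' : Set V)) S rfl).trans h1
  refine (iInf_le _ S.card).trans ?_
  rw [Nat.cast_add]
  gcongr

theorem exists_covers_le [Fintype V] {G : SimpleGraph V} (hG : G.Connected) {t : ℕ}
    (ht : 0 < t) (hn : Fintype.card V ≤ 14 * t ^ 2) :
    ∃ (S : Finset V) (r : ℕ), S.card + r ≤ 7 * t + 1 ∧ Covers G r S Finset.univ := by
  classical
  obtain ⟨u⟩ := hG.nonempty
  have hconn : (G.induce ((Finset.univ : Finset V) : Set V)).Connected := by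
    rw [Finset.coe_univ]
    exact (induceUnivIso G).connected_iff.2 hG
  obtain ⟨p, d, h⟩ := exists_isParentMap (Finset.mem_univ u) hconn
  obtain ⟨S₁, S₂, hS, h₁, h₂⟩ := h.exists_two_covers ht
  rw [Finset.card_univ] at hS
  have hsum : S₁.card + S₂.card ≤ 7 * t + 2 := by
    refine Nat.le_of_mul_le_mul_left (c := 2 * t) ?_ (by omega)
    nlinarith
  by_cases hc : S₁.card + 3 * t ≤ 7 * t + 1
  · exact ⟨S₁, 3 * t, hc, h₁⟩
  · exact ⟨S₂, 4 * t, by omega, h₂⟩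

end PSDForcing

theorem mainTheorem8 :
    ∃ C : ℝ, ∀ (V : Type*) [Fintype V] (T : SimpleGraph V), T.IsTree →
      ∃ m : ℕ, PSDForcing.thPlus T = (m : ℕ∞) ∧
        (m : ℝ) ≤ (Real.sqrt 14 / 2) * Real.sqrt (Fintype.card V : ℝ) + C := by
  -- `7⌈y⌉ + 1 < 7y + 8`.
  refine ⟨8, fun V _ T hT => ?_⟩
  obtain ⟨v⟩ := hT.connected.nonempty
  have hpos : (0 : ℝ) < Fintype.card V := Nat.cast_pos.2 (Fintype.card_pos_iff.2 ⟨v⟩)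
  set y : ℝ := Real.sqrt (Fintype.card V / 14) with hy
  have hy0 : 0 < y := Real.sqrt_pos.2 (by positivity)
  have hysq : y ^ 2 = Fintype.card V / 14 := Real.sq_sqrt (by positivity)
  have hle : y ≤ ⌈y⌉₊ := Nat.le_ceil y
  have hlt : (⌈y⌉₊ : ℝ) < y + 1 := Nat.ceil_lt_add_one hy0.le
  have hn : Fintype.card V ≤ 14 * ⌈y⌉₊ ^ 2 := by
    have : (Fintype.card V : ℝ) ≤ 14 * (⌈y⌉₊ : ℝ) ^ 2 := by nlinarith
    exact_mod_cast this
  obtain ⟨S, r, hSr, hcov⟩ :=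
    PSDForcing.exists_covers_le hT.connected (Nat.ceil_pos.2 hy0) hn
  have hth := PSDForcing.thPlus_le_of_covers hT.isAcyclic hcov
  obtain ⟨m, hm, hmle⟩ := ENat.le_natCast_iff.1 hth
  refine ⟨m, hm, ?_⟩
  have hmr : (m : ℝ) ≤ 7 * ⌈y⌉₊ + 1 := by exact_mod_cast hmle.trans hSr
  have h7 : Real.sqrt 14 / 2 * Real.sqrt (Fintype.card V : ℝ) = 7 * y := by
    rw [hy, Real.sqrt_div' _ (by norm_num), mul_div_assoc', div_mul_eq_mul_div,
      div_eq_div_iff (by norm_num) (by positivity)]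
    have := Real.mul_self_sqrt (show (0 : ℝ) ≤ 14 by norm_num)
    linear_combination Real.sqrt (Fintype.card V : ℝ) * this
  rw [h7]
  linarith
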